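/- Conventions. Algebras are finitary and may be empty; a variety is the class of all algebras (of a given signature) satisfying a given set of identities. It is congruence-modular (congruence-permutable) if for each of its algebras $B$ the lattice $\operatorname{Con} B$ is modular (any two congruences of $B$ commute under relational composition). A uniformity $\mathcal U$ on (the underlying set of) an algebra $A$, regarded as a filter of binary relations, is *compatible* if for every basic operation $\omega$ and every $U\in\mathcal U$ there is $\bar U\in\mathcal U$ such that $x_i\mathrel{\bar U}y_i$ for all $i$ implies $\omega(\mathbf x)\mathrel U\omega(\mathbf y)$. The set $\operatorname{Unif}A$ of compatible uniformities is ordered by reverse inclusion ($\mathcal U\le\mathcal V$ iff $\mathcal V\subseteq\mathcal U$); it is a complete lattice, with joins $\bigvee$. For $\alpha\in\operatorname{Con}A$, $\operatorname{Ug}\{\alpha\}$ is the least $\mathcal W\in\operatorname{Unif}A$ with $\alpha\subseteq W$ for all $W\in\mathcal W$. Let $\mathcal U\circ\mathcal V$ be the filter with base $\{U\circ V\mid U\in\mathcal U,\,V\in\mathcal V\}$; $\mathcal U$ and $\mathcal V$ *permute* if $\mathcal U\circ\mathcal V=\mathcal V\circ\mathcal U$. For $\mathcal U,\mathcal V,\mathcal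 W\in\operatorname{Unif}A$ we say that $\mathcal U$ *centralizes* $\mathcal V$ *modulo* $\mathcal W$ if for all $n,n'\ge 0$, all $(n+n')$-ary terms $t$ and all $W\in\mathcal W$ there are $U\in\mathcal U$, $V\in\mathcal V$, $\bar W\in\mathcal W$ such that for all $\mathbf a,\mathbf a'\in A^n$ and $\mathbf b,\mathbf c\in A^{n'}$ with $a_i\mathrel U a'_i$ and $b_j\mathrel V c_j$ for all $i,j$, $t(\mathbf a,\mathbf b)\mathrel{\bar W}t(\mathbf a,\mathbf c)$ implies $t(\mathbf a',\mathbf b)\mathrel W t(\mathbf a',\mathbf c)$. The *commutator* $[\mathcal U,\mathcal V]$ is the least $\mathcal W\in\operatorname{Unif}A$ such that $\mathcal U$ centralizes $\mathcal V$ modulo $\mathcal W$. The algebra $A$ *has an underlying group structure* if there is a group structure on $A$ whose multiplication and inversion are term operations of $A$. Theorem. Let $A$ be an algebra in a congruence-modular variety, let $(\mathcal U_i)_{i\in I}$ be a family in $\operatorname{Unif}A$, and let $\mathcal V\in\operatorname{Unif}A$. Then $$\bigvee_{i\in I}[\mathcal U_i,\mathcal V]\le\Bigl[\bigvee_{i\in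 I}\mathcal U_i,\mathcal V\Bigr].$$ Equality holds in each of the following cases: (a) $\mathcal V=\operatorname{Ug}\{\alpha\}$ for some $\alpha\in\operatorname{Con}A$ and $A$ has an underlying group structure; (b) $I$ is finite and the $\mathcal U_i$ permute pairwise. Corollary. If $A$ is an algebra in a congruence-permutable variety, then the commutator on $\operatorname{Unif}A$ is finitely additive: for every finite family $(\mathcal U_i)_{i\in I}$ in $\operatorname{Unif}A$ and every $\mathcal V\in\operatorname{Unif}A$, $[\bigvee_i\mathcal U_i,\mathcal V]=\bigvee_i[\mathcal U_i,\mathcal V]$ and $[\mathcal V,\bigvee_i\mathcal U_i]=\bigvee_i[\mathcal V,\mathcal U_i]$. -/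

import Mathlib

open FirstOrder FirstOrder.Language
open scoped Uniformity SetRel

universe u v w x

namespace UniformAlgebra

/- Algebras are structures of a first-order language `L` without relation symbols. -/

/-! ### Congruences and varieties -/

/-- The equivalence relation `s` is preserved by all basic operations. -/
def IsCongruence (L : FirstOrder.Language.{u, v}) (A : Type w) [L.Structure A] (s : Setoid A) : Prop :=
  ∀ ⦃n : ℕ⦄ (f : L.Functions n) (a b : Fin n → A),
    (∀ i, s.r (a i) (b i)) → s.r (Structure.funMap f a) (Structure.funMap f b)

/-- The congruences of the algebra `A`, ordered by inclusion. -/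
def Congruence (L : FirstOrder.Language.{u, v}) (A : Type w) [L.Structure A] : Type w :=
  {s : Setoid A // IsCongruence L A s}

section Congruence

variable {L : FirstOrder.Language.{u, v}} {A : Type w} [L.Structure A]

instance : PartialOrder (Congruence L A) :=
  inferInstanceAs (PartialOrder {s : Setoid A // IsCongruence L A s})

theorem isCongruence_sInf (S : Set (Congruence L A)) :
    IsCongruence L A (sInf (Subtype.val '' S)) := by
  intro n f a b h
  rintro _ ⟨s, hs, rfl⟩
  exact s.2 f a b fun i => h i s.1 ⟨s, hs, rfl⟩

instance : InfSet (Congruence L A) := ⟨fun S => ⟨sInf (Subtype.val '' S), isCongruence_sInf S⟩⟩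

/-- The lattice of congruences; meets are intersections. -/
instance : CompleteLattice (Congruence L A) :=
  completeLatticeOfInf _ fun S =>
    ⟨fun s hs => show sInf (Subtype.val '' S) ≤ s.1 from sInf_le ⟨s, hs, rfl⟩,
     fun s hs => show s.1 ≤ sInf (Subtype.val '' S) from
      le_sInf (by rintro _ ⟨t, ht, rfl⟩; exact hs ht)⟩

end Congruence

/-- A set of identities, in the variables `0, 1, 2, …`. It presents the variety of all algebras
that satisfy every one of these identities. -/
abbrev Identities (L : FirstOrder.Language.{u, v}) : Type u := Set (L.Term ℕ × L.Term ℕ)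

/-- `A` belongs to the variety presented by `E`. -/
def Models {L : FirstOrder.Language.{u, v}} (E : Identities L) (A : Type w) [L.Structure A] : Prop :=
  ∀ e ∈ E, ∀ y : ℕ → A, e.1.realize y = e.2.realize y

/-- The variety presented by `E` is congruence-modular. -/
def CongruenceModular {L : FirstOrder.Language.{u, v}} (E : Identities L) : Prop :=
  ∀ (B : Type (max u w)) [L.Structure B], Models E B → IsModularLattice (Congruence L B)

/-- The variety presented by `E` is congruence-permutable. -/
def CongruencePermutable {L : FirstOrder.Language.{u, v}} (E : Identities L) : Prop :=
  ∀ (B : Type (max u w)) [L.Structure B], Models E B →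
    ∀ α β : Congruence L B, Relation.Comp α.1.r β.1.r = Relation.Comp β.1.r α.1.r

/-! ### Compatible uniformities -/

/-- Every basic operation is uniformly continuous: for every entourage `U` and every `f` there
is an entourage `U'` with `f(U') ⊆ U`. -/
def IsCompatible (L : FirstOrder.Language.{u, v}) (A : Type w) [L.Structure A] (𝒰 : UniformSpace A) : Prop :=
  ∀ ⦃n : ℕ⦄ (f : L.Functions n), ∀ U ∈ 𝓤[𝒰], ∃ U' ∈ 𝓤[𝒰], ∀ a b : Fin n → A,
    (∀ i, (a i, b i) ∈ U') → (Structure.funMap f a, Structure.funMap f b) ∈ U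

/-- The compatible uniformities of the algebra `A`, ordered by reverse inclusion of their sets
of entourages (so the discrete uniformity is the least one). -/
def Unif (L : FirstOrder.Language.{u, v}) (A : Type w) [L.Structure A] : Type w :=
  {𝒰 : UniformSpace A // IsCompatible L A 𝒰}

section Unif

variable {L : FirstOrder.Language.{u, v}} {A : Type w} [L.Structure A]

/-- The filter of entourages. -/
def Unif.ent (𝒰 : Unif L A) : Filter (A × A) := 𝓤[𝒰.1]

instance : PartialOrder (Unif L A) :=
  inferInstanceAs (PartialOrder {𝒰 : UniformSpace A // IsCompatible L A 𝒰})

theorem isCompatible_sInf (S : Set (Unif L A)) :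
    IsCompatible L A (sInf (Subtype.val '' S)) := by
  intro n f
  let G : Filter (A × A) :=
    { sets := {U | ∃ U' ∈ 𝓤[sInf (Subtype.val '' S)], ∀ a b : Fin n → A,
        (∀ i, (a i, b i) ∈ U') → (Structure.funMap f a, Structure.funMap f b) ∈ U}
      univ_sets := ⟨Set.univ, Filter.univ_mem, fun _ _ _ => trivial⟩
      sets_of_superset := by
        rintro U V ⟨U', hU', h⟩ hUV
        exact ⟨U', hU', fun a b hab => hUV (h a b hab)⟩
      inter_sets := by
        rintro U V ⟨U', hU', h⟩ ⟨V', hV', k⟩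
        exact ⟨U' ∩ V', Filter.inter_mem hU' hV', fun a b hab =>
          ⟨h a b fun i => (hab i).1, k a b fun i => (hab i).2⟩⟩ }
  have key : G ≤ 𝓤[sInf (Subtype.val '' S)] := by
    rw [sInf_eq_iInf', iInf_uniformity]
    refine le_iInf ?_
    rintro ⟨_, 𝒲, h𝒲, rfl⟩ U hU
    obtain ⟨U', hU', h⟩ := 𝒲.2 f U hU
    have hle : sInf (Subtype.val '' S) ≤ 𝒲.1 := sInf_le ⟨𝒲, h𝒲, rfl⟩
    exact ⟨U', hle hU', h⟩
  exact fun U hU => key hU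

instance : InfSet (Unif L A) := ⟨fun S => ⟨sInf (Subtype.val '' S), isCompatible_sInf S⟩⟩

/-- The complete lattice of compatible uniformities. The meet of a family is its meet as a family
of filters, and its join is the least compatible uniformity that is above all members. -/
instance : CompleteLattice (Unif L A) :=
  completeLatticeOfInf _ fun S =>
    ⟨fun s hs => show sInf (Subtype.val '' S) ≤ s.1 from sInf_le ⟨s, hs, rfl⟩,
     fun s hs => show s.1 ≤ sInf (Subtype.val '' S) from
      le_sInf (by rintro _ ⟨t, ht, rfl⟩; exact hs ht)⟩

/-- `Ug R`: the least compatible uniformity above the filter of relations `R`. -/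
def Ug (R : Filter (A × A)) : Unif L A := sInf {𝒲 | R ≤ 𝒲.ent}

/-- `Ug {α}` for a congruence `α`. -/
def ugCongruence (α : Congruence L A) : Unif L A :=
  Ug (Filter.principal {p : A × A | α.1.r p.1 p.2})

/-- `𝒰 ∘ 𝒱 = 𝒱 ∘ 𝒰`, where `𝒰 ∘ 𝒱` is the filter with base all `U ∘ V`, `U ∈ 𝒰`, `V ∈ 𝒱`. -/
def Permute (𝒰 𝒱 : Unif L A) : Prop :=
  (𝒰.ent.lift fun U => 𝒱.ent.lift' fun V => U ○ V) =
    𝒱.ent.lift fun V => 𝒰.ent.lift' fun U => V ○ U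

/-! ### Centralization and the commutator -/

/-- `C(𝒰, 𝒱; 𝒲)`: the uniformity `𝒰` centralizes `𝒱` modulo `𝒲`, that is, `𝒲` satisfies the
`𝒰, 𝒱`-term condition. -/
def Centralizes (𝒰 𝒱 𝒲 : Unif L A) : Prop :=
  ∀ (n n' : ℕ) (t : L.Term (Fin n ⊕ Fin n')), ∀ W ∈ 𝒲.ent,
    ∃ U ∈ 𝒰.ent, ∃ V ∈ 𝒱.ent, ∃ W' ∈ 𝒲.ent,
      ∀ (a a' : Fin n → A) (b c : Fin n' → A),
        (∀ i, (a i, a' i) ∈ U) → (∀ j, (b j, c j) ∈ V) →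
        (t.realize (Sum.elim a b), t.realize (Sum.elim a c)) ∈ W' →
        (t.realize (Sum.elim a' b), t.realize (Sum.elim a' c)) ∈ W

/-- The commutator `[𝒰, 𝒱]`: the least compatible uniformity `𝒲` such that `C(𝒰, 𝒱; 𝒲)`. -/
def comm (𝒰 𝒱 : Unif L A) : Unif L A := sInf {𝒲 | Centralizes 𝒰 𝒱 𝒲}

/-- There is indeed a least such uniformity. -/
theorem isLeast_comm (𝒰 𝒱 : Unif L A) : IsLeast {𝒲 | Centralizes 𝒰 𝒱 𝒲} (comm 𝒰 𝒱) := by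
  refine ⟨?_, fun 𝒲 h => sInf_le h⟩
  intro n n' t
  let G : Filter (A × A) :=
    { sets := {W | ∃ U ∈ 𝒰.ent, ∃ V ∈ 𝒱.ent, ∃ W' ∈ (comm 𝒰 𝒱).ent,
        ∀ (a a' : Fin n → A) (b c : Fin n' → A),
        (∀ i, (a i, a' i) ∈ U) → (∀ j, (b j, c j) ∈ V) →
        (t.realize (Sum.elim a b), t.realize (Sum.elim a c)) ∈ W' →
        (t.realize (Sum.elim a' b), t.realize (Sum.elim a' c)) ∈ W}
      univ_sets := ⟨Set.univ, Filter.univ_mem, Set.univ, Filter.univ_mem, Set.univ,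
        Filter.univ_mem, fun _ _ _ _ _ _ _ => trivial⟩
      sets_of_superset := by
        rintro W X ⟨U, hU, V, hV, W', hW', h⟩ hWX
        exact ⟨U, hU, V, hV, W', hW', fun a a' b c h1 h2 h3 => hWX (h a a' b c h1 h2 h3)⟩
      inter_sets := by
        rintro W X ⟨U, hU, V, hV, W', hW', h⟩ ⟨U2, hU2, V2, hV2, X', hX', k⟩
        exact ⟨U ∩ U2, Filter.inter_mem hU hU2, V ∩ V2, Filter.inter_mem hV hV2, W' ∩ X',
          Filter.inter_mem hW' hX', fun a a' b c h1 h2 h3 =>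
          ⟨h a a' b c (fun i => (h1 i).1) (fun j => (h2 j).1) h3.1,
           k a a' b c (fun i => (h1 i).2) (fun j => (h2 j).2) h3.2⟩⟩ }
  have key : G ≤ (comm 𝒰 𝒱).ent := by
    change G ≤ 𝓤[sInf (Subtype.val '' {𝒲 | Centralizes 𝒰 𝒱 𝒲})]
    rw [sInf_eq_iInf', iInf_uniformity]
    refine le_iInf ?_
    rintro ⟨_, 𝒲, h𝒲, rfl⟩ W hW
    obtain ⟨U, hU, V, hV, W', hW', h⟩ := h𝒲 n n' t W hW
    have hle : comm 𝒰 𝒱 ≤ 𝒲 := sInf_le h𝒲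
    have hle' : (comm 𝒰 𝒱).1 ≤ 𝒲.1 := hle
    exact ⟨U, hU, V, hV, W', hle' hW', h⟩
  exact fun W hW => key hW

end Unif

/-- `A` has an underlying group structure: there is a group structure on `A` whose
multiplication and inversion are term operations of `A` (hence so is the constant `x * x⁻¹`). -/
def HasUnderlyingGroup (L : FirstOrder.Language.{u, v}) (A : Type w) [L.Structure A] : Prop :=
  ∃ (_ : Group A) (m : L.Term (Fin 2)) (i : L.Term (Fin 1)),
    (∀ y z : A, m.realize ![y, z] = y * z) ∧ ∀ y : A, i.realize ![y] = y⁻¹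

end UniformAlgebra

/-!
The inequality holds because `Centralizes` is antitone in its first argument. For the equalities,
`𝒲 = ⨆ i, [𝒰 i, 𝒱]` has to satisfy the term condition for `⨆ i, 𝒰 i`, and this rests on three
observations.

* `Centralizes 𝒰 𝒱 𝒲` is an implication with `𝒲` on both sides, so its monotonicity in `𝒲` is not
  clear. Congruence modularity supplies Day terms (`hasDayTerms_of_modular`), and these make it
  equivalent to the unconditional statement `CentralDiff 𝒰 𝒱 𝒲`
  (`centralizes_iff_centralDiff`): one applies the term condition with `𝒰` and `𝒱` exchanged to
  `m(t(e, b), t(x, b), t(x, y), t(e, y))`, and telescopes along the chain of Day terms. Hence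
  `[𝒰, 𝒱] ≤ 𝒲` if and only if `𝒰` centralizes `𝒱` modulo `𝒲` (`comm_le_iff`), and the commutator
  is symmetric (`comm_comm`).
* If `𝒰` and `𝒰'` permute, the sets `U ∘ U'` belong to `𝒰 ⊔ 𝒰'` (`SemiPermute.comp_mem_sup`), so
  the term condition passes to `𝒰 ⊔ 𝒰'` through an intermediate tuple. In a congruence-permutable
  variety a Mal'cev term makes all compatible uniformities permute.
* In the presence of a group structure and for `𝒱 = Ug {α}`, centralization is uniform
  equicontinuity of the functions `a ↦ t(a, b) t(a, c)⁻¹` with `b α c`. The largest compatible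
  uniformity with this property lies above every `𝒰 i`, hence above their join
  (`centralizes_iSup_of_group`). It matters here that `α` itself is an entourage of `Ug {α}`, so
  that the closeness of `b` and `c` does not depend on `i`.
-/

namespace UniformAlgebra

/-! ### Entourages of compatible uniformities -/

section Entourages

variable {L : FirstOrder.Language.{u, v}} {A : Type w} [L.Structure A]

theorem Unif.le_iff {𝒰 𝒱 : Unif L A} : 𝒰 ≤ 𝒱 ↔ ∀ V ∈ 𝒱.ent, V ∈ 𝒰.ent := Iff.rfl

theorem Unif.ent_refl {𝒰 : Unif L A} {U : Set (A × A)} (hU : U ∈ 𝒰.ent) (a : A) : (a, a) ∈ U :=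
  @mem_uniformity_of_eq A 𝒰.1 _ _ _ hU rfl

theorem Unif.ent_symm {𝒰 : Unif L A} {U : Set (A × A)} (hU : U ∈ 𝒰.ent) :
    ∃ U' ∈ 𝒰.ent, ∀ a b, (a, b) ∈ U' → (b, a) ∈ U :=
  ⟨Prod.swap ⁻¹' U, @symm_le_uniformity A 𝒰.1 U hU, fun _ _ h => h⟩

theorem Unif.ent_comp {𝒰 : Unif L A} {U : Set (A × A)} (hU : U ∈ 𝒰.ent) :
    ∃ U' ∈ 𝒰.ent, ∀ a b c, (a, b) ∈ U' → (b, c) ∈ U' → (a, c) ∈ U := by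
  obtain ⟨U', hU', h⟩ := @comp_mem_uniformity_sets A 𝒰.1 U hU
  exact ⟨U', hU', fun a b c h1 h2 => h ⟨b, h1, h2⟩⟩

/-- A family of reflexive relations that is closed, up to refinement, under inverses and
composition, and on whose filter the basic operations are continuous, generates a compatible
uniformity. -/
theorem exists_unif_of_relations {κ : Type*} (T : κ → Set (A × A))
    (refl : ∀ k a, (a, a) ∈ T k)
    (symm : ∀ k, ∃ k', ∀ a b, (a, b) ∈ T k' → (b, a) ∈ T k)
    (comp : ∀ k, ∃ k', ∀ a b c, (a, b) ∈ T k' → (b, c) ∈ T k' → (a, c) ∈ T k)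
    (compat : ∀ ⦃n : ℕ⦄ (f : L.Functions n) k, ∃ U ∈ ⨅ k, Filter.principal (T k),
      ∀ a b : Fin n → A, (∀ i, (a i, b i) ∈ U) →
        (Structure.funMap f a, Structure.funMap f b) ∈ T k) :
    ∃ 𝒯 : Unif L A, 𝒯.ent = ⨅ k, Filter.principal (T k) := by
  have mem : ∀ k, T k ∈ ⨅ k, Filter.principal (T k) :=
    fun k => Filter.mem_iInf_of_mem k (Filter.mem_principal_self _)
  let C : UniformSpace.Core A :=
    { uniformity := ⨅ k, Filter.principal (T k)
      refl := by
        refine le_iInf fun k => Filter.principal_mono.2 ?_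
        rintro ⟨a, b⟩ h
        obtain rfl : a = b := h
        exact refl k a
      symm := by
        refine Filter.tendsto_iInf.2 fun k => Filter.tendsto_principal.2 ?_
        obtain ⟨k', h⟩ := symm k
        exact Filter.mem_of_superset (mem k') fun p hp => h p.1 p.2 hp
      comp := by
        refine le_iInf fun k => Filter.le_principal_iff.2 ?_
        obtain ⟨k', h⟩ := comp k
        refine Filter.mem_of_superset (Filter.mem_lift' (mem k')) ?_
        rintro ⟨a, c⟩ ⟨b, h1, h2⟩
        exact h a b c h1 h2 }
  refine ⟨⟨UniformSpace.ofCore C, ?_⟩, rfl⟩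
  intro n f
  let G : Filter (A × A) :=
    { sets := {U | ∃ U' ∈ ⨅ k, Filter.principal (T k), ∀ a b : Fin n → A,
        (∀ i, (a i, b i) ∈ U') → (Structure.funMap f a, Structure.funMap f b) ∈ U}
      univ_sets := ⟨Set.univ, Filter.univ_mem, fun _ _ _ => trivial⟩
      sets_of_superset := by
        rintro U V ⟨U', hU', h⟩ hUV
        exact ⟨U', hU', fun a b hab => hUV (h a b hab)⟩
      inter_sets := by
        rintro U V ⟨U', hU', h⟩ ⟨V', hV', k⟩
        exact ⟨U' ∩ V', Filter.inter_mem hU' hV', fun a b hab =>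
          ⟨h a b fun i => (hab i).1, k a b fun i => (hab i).2⟩⟩ }
  have key : G ≤ ⨅ k, Filter.principal (T k) :=
    le_iInf fun k => Filter.le_principal_iff.2 (compat f k)
  exact fun U hU => key hU

theorem exists_unif_of_congruence (α : Congruence L A) :
    ∃ 𝒯 : Unif L A, 𝒯.ent = Filter.principal {p : A × A | α.1.r p.1 p.2} := by
  simpa only [iInf_const] using exists_unif_of_relations (L := L)
    (fun _ : Unit => {p : A × A | α.1.r p.1 p.2})
    (fun _ a => α.1.refl a) (fun k => ⟨k, fun _ _ h => α.1.symm h⟩)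
    (fun k => ⟨k, fun _ _ _ h h' => α.1.trans h h'⟩)
    (fun n f k => ⟨_, Filter.mem_iInf_of_mem k (Filter.mem_principal_self _), fun a b => α.2 f a b⟩)

/-- The relation `α` alone is a base of `Ug {α}`. -/
theorem ugCongruence_ent (α : Congruence L A) :
    (ugCongruence α).ent = Filter.principal {p : A × A | α.1.r p.1 p.2} := by
  obtain ⟨𝒯, h𝒯⟩ := exists_unif_of_congruence α
  refine le_antisymm ?_ ?_
  · have h : ugCongruence α ≤ 𝒯 := sInf_le (show _ ≤ 𝒯.ent from h𝒯.ge)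
    rw [← h𝒯]
    exact fun U hU => Unif.le_iff.1 h U hU
  · have h : 𝒯 ≤ ugCongruence α :=
      le_sInf fun 𝒲 h𝒲 => Unif.le_iff.2 fun W hW => h𝒯 ▸ h𝒲 hW
    rw [← h𝒯]
    exact fun U hU => Unif.le_iff.1 h U hU

/-- Term operations are uniformly continuous. -/
theorem Unif.exists_ent_term (𝒰 : Unif L A) {ι : Type*} (t : L.Term ι) :
    ∀ U ∈ 𝒰.ent, ∃ U' ∈ 𝒰.ent, ∀ a b : ι → A, (∀ i, (a i, b i) ∈ U') →
      (t.realize a, t.realize b) ∈ U := by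
  induction t with
  | var i => exact fun U hU => ⟨U, hU, fun a b h => h i⟩
  | func f ts ih =>
    intro U hU
    obtain ⟨U', hU', h⟩ := 𝒰.2 f U hU
    choose X hX hX' using fun i => ih i U' hU'
    exact ⟨⋂ i, X i, Filter.iInter_mem.2 hX, fun a b hab =>
      h _ _ fun i => hX' i a b fun j => Set.mem_iInter.1 (hab j) i⟩

end Entourages

/-! ### The symmetric form of centralization -/

section CentralDiff

variable {L : FirstOrder.Language.{u, v}} {A : Type w} [L.Structure A]

/-- For every term `t` and all `𝒰`-close `a, a'` and `𝒱`-close `b, c`, the elements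
`m(t(a',b), t(a',b), t(a',c), t(a',c))` and `m(t(a',b), t(a,b), t(a,c), t(a',c))` are `𝒲`-close.
Here `m` is any quaternary term that satisfies `m(x, y, y, x) = x` in `A`. Unlike `Centralizes`,
this is an unconditional statement, hence visibly monotone in `𝒲`. -/
def CentralDiff (𝒰 𝒱 𝒲 : Unif L A) : Prop :=
  ∀ m : L.Term (Fin 4), (∀ y z : A, m.realize ![y, z, z, y] = y) →
    ∀ (n n' : ℕ) (t : L.Term (Fin n ⊕ Fin n')), ∀ W ∈ 𝒲.ent, ∃ U ∈ 𝒰.ent, ∃ V ∈ 𝒱.ent,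
      ∀ (a a' : Fin n → A) (b c : Fin n' → A),
        (∀ i, (a i, a' i) ∈ U) → (∀ j, (b j, c j) ∈ V) →
        (m.realize ![t.realize (Sum.elim a' b), t.realize (Sum.elim a' b),
            t.realize (Sum.elim a' c), t.realize (Sum.elim a' c)],
          m.realize ![t.realize (Sum.elim a' b), t.realize (Sum.elim a b),
            t.realize (Sum.elim a c), t.realize (Sum.elim a' c)]) ∈ W

theorem CentralDiff.mono {𝒰 𝒱 𝒲 𝒲' : Unif L A} (h : CentralDiff 𝒰 𝒱 𝒲) (hle : 𝒲 ≤ 𝒲') :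
    CentralDiff 𝒰 𝒱 𝒲' :=
  fun m hm n n' t W hW => h m hm n n' t W (Unif.le_iff.1 hle W hW)

theorem realize_subst_four {ι : Type*} (m : L.Term (Fin 4)) (t₀ t₁ t₂ t₃ : L.Term ι) (y : ι → A) :
    (m.subst ![t₀, t₁, t₂, t₃]).realize y =
      m.realize ![t₀.realize y, t₁.realize y, t₂.realize y, t₃.realize y] := by
  rw [Term.realize_subst]
  congr 1
  funext k
  fin_cases k <;> rfl

/-- Term condition with the roles of `𝒰` and `𝒱` exchanged. It is applied to the term
`m(t(e, b), t(x, b), t(x, y), t(e, y))`, in which the variables `b, y` are moved along `𝒱` and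
`e, x` along `𝒰`; its value at `y = b` does not depend on `x`. -/
theorem Centralizes.centralDiff {𝒰 𝒱 𝒲 : Unif L A} (h : Centralizes 𝒱 𝒰 𝒲) :
    CentralDiff 𝒰 𝒱 𝒲 := by
  intro m hm n n' t W hW
  let r (g : Fin n → Fin (n + n)) (g' : Fin n' → Fin (n' + n')) :
      L.Term (Fin (n' + n') ⊕ Fin (n + n)) :=
    t.relabel (Sum.elim (fun i => Sum.inr (g i)) fun j => Sum.inl (g' j))
  let s : L.Term (Fin (n' + n') ⊕ Fin (n + n)) :=
    m.subst ![r (Fin.castAdd n) (Fin.castAdd n'), r (Fin.natAdd n) (Fin.castAdd n'),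
      r (Fin.natAdd n) (Fin.natAdd n'), r (Fin.castAdd n) (Fin.natAdd n')]
  have hr : ∀ (g g') (y : Fin (n' + n') → A) (x : Fin (n + n) → A),
      (r g g').realize (Sum.elim y x) =
        t.realize (Sum.elim (fun i => x (g i)) fun j => y (g' j)) := by
    intro g g' y x
    rw [Term.realize_relabel]
    congr 1
    funext k
    cases k <;> rfl
  have hs : ∀ (b y : Fin n' → A) (e x : Fin n → A),
      s.realize (Sum.elim (Fin.append b y) (Fin.append e x)) =
        m.realize ![t.realize (Sum.elim e b), t.realize (Sum.elim x b),
          t.realize (Sum.elim x y), t.realize (Sum.elim e y)] := by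
    intro b y e x
    simp only [s, realize_subst_four, hr, Fin.append_left, Fin.append_right]
  obtain ⟨V, hV, U, hU, W', hW', H⟩ := h _ _ s W hW
  obtain ⟨U', hU', hsymm⟩ := Unif.ent_symm hU
  refine ⟨U', hU', V, hV, fun a a' b c ha hb => ?_⟩
  have := H (Fin.append b b) (Fin.append b c) (Fin.append a' a') (Fin.append a' a)
    (by
      intro j
      refine Fin.addCases (fun j => ?_) (fun j => ?_) j
      · simpa only [Fin.append_left] using Unif.ent_refl hV _
      · simpa only [Fin.append_right] using hb j)
    (by
      intro i
      refine Fin.addCases (fun i => ?_) (fun i => ?_) i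
      · simpa only [Fin.append_left] using Unif.ent_refl hU _
      · simpa only [Fin.append_right] using hsymm _ _ (ha i))
    (by
      rw [hs, hs, hm, hm]
      exact Unif.ent_refl hW' _)
  rwa [hs, hs] at this

end CentralDiff

/-! ### Day terms -/

section TermOp

/-- The algebra of `ι`-ary term operations of `A`, under pointwise operations. Its universe is
raised so that it is among the algebras over which `CongruenceModular` and
`CongruencePermutable` quantify. -/
structure TermOp (L : FirstOrder.Language.{u, v}) (A : Type w) [L.Structure A] (ι : Type) :
    Type (max u w) where
  toFun : (ι → A) → A
  isTerm : ∃ t : L.Term ι, ∀ y, t.realize y = toFun y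

variable {L : FirstOrder.Language.{u, v}} {A : Type w} [L.Structure A] {ι : Type}

/-- The language is meant to be algebraic, so the interpretation of relation symbols is
irrelevant. -/
instance : L.Structure (TermOp L A ι) where
  funMap f g := ⟨fun y => Structure.funMap f fun i => (g i).toFun y, by
    choose t ht using fun i => (g i).isTerm
    exact ⟨Term.func f t, fun y => by simp only [Term.realize_func, ht]⟩⟩
  RelMap _ _ := False

theorem TermOp.realize_toFun {κ : Type*} (t : L.Term κ) (g : κ → TermOp L A ι) (y : ι → A) :
    (t.realize g).toFun y = t.realize fun k => (g k).toFun y := by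
  induction t with
  | var k => rfl
  | func f ts ih =>
    change Structure.funMap f (fun i => ((ts i).realize g).toFun y) = _
    simp only [ih, Term.realize_func]

theorem TermOp.ext' {g h : TermOp L A ι} (H : ∀ y, g.toFun y = h.toFun y) : g = h := by
  obtain ⟨g, _⟩ := g
  obtain ⟨h, _⟩ := h
  obtain rfl : g = h := funext H
  rfl

theorem models_termOp {E : Identities L} (hA : Models E A) : Models E (TermOp L A ι) := by
  intro e he g
  refine TermOp.ext' fun y => ?_
  rw [TermOp.realize_toFun, TermOp.realize_toFun]
  exact hA e he _

/-- The `i`-th projection. -/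
def TermOp.proj (L : FirstOrder.Language.{u, v}) (A : Type w) [L.Structure A] (i : ι) :
    TermOp L A ι :=
  ⟨fun y => y i, Term.var i, fun _ => rfl⟩

/-- The congruence that relates two term operations if they agree on all tuples `p z`. -/
def TermOp.agree (L : FirstOrder.Language.{u, v}) {A : Type w} [L.Structure A] {ζ : Type*}
    (p : ζ → ι → A) : Congruence L (TermOp L A ι) :=
  ⟨{ r := fun g h => ∀ z, g.toFun (p z) = h.toFun (p z)
     iseqv := ⟨fun _ _ => rfl, fun h z => (h z).symm, fun h k z => (h z).trans (k z)⟩ },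
   fun _ f _ _ H z => congrArg (Structure.funMap f) (funext fun i => H i z)⟩

/-- Consecutive members of a chain of Day terms: both satisfy `m(x, y, y, x) = x` as soon as one
does, and they agree on all `(x, x, u, u)` or on all `(x, y, y, u)`. -/
def DayStep (m m' : TermOp L A (Fin 4)) : Prop :=
  (∀ y z : A, m.toFun ![y, z, z, y] = m'.toFun ![y, z, z, y]) ∧
    ((∀ y z : A, m.toFun ![y, y, z, z] = m'.toFun ![y, y, z, z]) ∨
      ∀ x y z : A, m.toFun ![x, y, y, z] = m'.toFun ![x, y, y, z])

/-- A chain of Day terms leads from the first projection to the last one. -/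
def HasDayTerms (L : FirstOrder.Language.{u, v}) (A : Type w) [L.Structure A] : Prop :=
  Relation.ReflTransGen DayStep (TermOp.proj L A (0 : Fin 4)) (TermOp.proj L A 3)

/-- The join of two congruences relates only elements that a finite chain connects. -/
theorem Congruence.reflTransGen_of_sup {B : Type w} [L.Structure B] (α β : Congruence L B) {x y : B}
    (h : (α ⊔ β).1.r x y) : Relation.ReflTransGen (fun x y => α.1.r x y ∨ β.1.r x y) x y := by
  let R := Relation.ReflTransGen fun x y => α.1.r x y ∨ β.1.r x y
  have : Std.Symm fun x y => α.1.r x y ∨ β.1.r x y :=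
    ⟨fun _ _ h => h.imp (fun h => α.1.symm h) fun h => β.1.symm h⟩
  let γ : Setoid B :=
    { r := R
      iseqv := ⟨fun _ => .refl, fun h => Relation.ReflTransGen.stdSymm.symm _ _ h,
        fun h k => h.trans k⟩ }
  have hγ : IsCongruence L B γ := by
    intro n f a b hab
    have key : ∀ (s : Finset (Fin n)) (a : Fin n → B), (∀ i, R (a i) (b i)) →
        (∀ i ∉ s, a i = b i) → R (Structure.funMap f a) (Structure.funMap f b) := by
      intro s
      induction s using Finset.induction_on with
      | empty =>
        intro a _ h
        obtain rfl : a = b := funext fun i => h i (Finset.notMem_empty i)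
        exact .refl
      | insert i s _ ih =>
        intro a hR h
        have h1 : R (Structure.funMap f a) (Structure.funMap f (Function.update a i (b i))) := by
          have up : ∀ (δ : Congruence L B) {x y : B}, δ.1.r x y →
              δ.1.r (Structure.funMap f (Function.update a i x))
                (Structure.funMap f (Function.update a i y)) := by
            intro δ x y hxy
            refine δ.2 f _ _ fun j => ?_
            by_cases hj : j = i
            · subst hj; simpa using hxy
            · simp [hj]
          have := Relation.ReflTransGen.lift (p := fun x y => α.1.r x y ∨ β.1.r x y)
            (fun x => Structure.funMap f (Function.update a i x))
            (fun x y h => h.imp (up α) (up β)) _ _ (hR i)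
          change Relation.ReflTransGen _ _ _ at this
          simpa using this
        refine h1.trans (ih _ (fun j => ?_) fun j hj => ?_)
        · by_cases hj : j = i
          · subst hj; simpa using (Relation.ReflTransGen.refl : R (b j) (b j))
          · simpa [hj] using hR j
        · by_cases hji : j = i
          · subst hji; simp
          · simpa [hji] using h j (by simp [hji, hj])
    exact key Finset.univ a hab fun i hi => absurd (Finset.mem_univ i) hi
  have hle : α ⊔ β ≤ (⟨γ, hγ⟩ : Congruence L B) :=
    sup_le (fun _ _ h => .single (Or.inl h)) fun _ _ h => .single (Or.inr h)
  exact hle h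

/-- Day's theorem: the modular law is applied to the congruences of the algebra of quaternary term
operations that express the identifications `(x, x, u, u)`, `(x, y, y, u)` and `(x, y, y, x)`. -/
theorem hasDayTerms_of_modular {E : Identities L} (hA : Models E A)
    (hE : CongruenceModular.{u, v, w} E) : HasDayTerms L A := by
  have := hE (TermOp L A (Fin 4)) (models_termOp hA)
  let θ : Congruence L (TermOp L A (Fin 4)) :=
    TermOp.agree L fun q : A × A => ![q.1, q.1, q.2, q.2]
  let ψ : Congruence L (TermOp L A (Fin 4)) :=
    TermOp.agree L fun q : A × A × A => ![q.1, q.2.1, q.2.1, q.2.2]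
  let φ : Congruence L (TermOp L A (Fin 4)) :=
    TermOp.agree L fun q : A × A => ![q.1, q.2, q.2, q.1]
  have hψφ : ψ ≤ φ := fun _ _ h q => h (q.1, q.2, q.1)
  have hsup : (ψ ⊔ θ).1.r (TermOp.proj L A 0) (TermOp.proj L A 3) := by
    have hψ : ψ ≤ ψ ⊔ θ := le_sup_left
    have hθ : θ ≤ ψ ⊔ θ := le_sup_right
    have h1 : (ψ ⊔ θ).1.r (TermOp.proj L A 0) (TermOp.proj L A 1) := hθ fun _ => rfl
    have h2 : (ψ ⊔ θ).1.r (TermOp.proj L A 1) (TermOp.proj L A 2) := hψ fun _ => rfl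
    have h3 : (ψ ⊔ θ).1.r (TermOp.proj L A 2) (TermOp.proj L A 3) := hθ fun _ => rfl
    exact (ψ ⊔ θ).1.trans ((ψ ⊔ θ).1.trans h1 h2) h3
  have hφ : φ.1.r (TermOp.proj L A 0) (TermOp.proj L A 3) := fun _ => rfl
  have hinf : ((ψ ⊔ θ) ⊓ φ).1.r (TermOp.proj L A 0) (TermOp.proj L A 3) := by
    rintro _ ⟨δ, hδ, rfl⟩
    rcases hδ with rfl | rfl
    · exact hsup
    · exact hφ
  have hmod : (ψ ⊔ θ) ⊓ φ ≤ ψ ⊔ θ ⊓ φ := IsModularLattice.sup_inf_le_assoc_of_le θ hψφ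
  have hle1 : θ ⊓ φ ≤ θ := inf_le_left
  have hle2 : θ ⊓ φ ≤ φ := inf_le_right
  refine Relation.ReflTransGen.mono ?_ _ _ (Congruence.reflTransGen_of_sup ψ (θ ⊓ φ) (hmod hinf))
  rintro m m' (h | h)
  · exact ⟨fun y z => hψφ h (y, z), Or.inr fun x y z => h (x, y, z)⟩
  · exact ⟨fun y z => hle2 h (y, z), Or.inl fun y z => hle1 h (y, z)⟩

/-- A Mal'cev operation, with `p(x, y, y) = x` and `p(y, y, x) = x`, among the term operations. -/
theorem exists_malcev {E : Identities L} (hA : Models E A)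
    (hE : CongruencePermutable.{u, v, w} E) : ∃ p : L.Term (Fin 3),
      (∀ y z : A, p.realize ![y, z, z] = y) ∧ ∀ y z : A, p.realize ![y, y, z] = z := by
  have h := hE (TermOp L A (Fin 3)) (models_termOp hA)
    (TermOp.agree L fun q : A × A => ![q.1, q.1, q.2])
    (TermOp.agree L fun q : A × A => ![q.1, q.2, q.2])
  have h02 : Relation.Comp
      (TermOp.agree L fun q : A × A => ![q.1, q.1, q.2]).1.r
      (TermOp.agree L fun q : A × A => ![q.1, q.2, q.2]).1.r
      (TermOp.proj L A (0 : Fin 3)) (TermOp.proj L A 2) :=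
    ⟨TermOp.proj L A 1, fun _ => rfl, fun _ => rfl⟩
  rw [h] at h02
  obtain ⟨g, h1, h2⟩ := h02
  obtain ⟨p, hp⟩ := g.isTerm
  exact ⟨p, fun y z => (hp _).trans (h1 (y, z)).symm, fun y z => (hp _).trans (h2 (y, z))⟩

/-- The Day terms are `x`, `p(y, z, u)` and `u`. -/
theorem hasDayTerms_of_malcev (p : L.Term (Fin 3)) (h1 : ∀ y z : A, p.realize ![y, z, z] = y)
    (h2 : ∀ y z : A, p.realize ![y, y, z] = z) : HasDayTerms L A := by
  let g : TermOp L A (Fin 4) :=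
    ⟨fun y => p.realize ![y 1, y 2, y 3], p.relabel ![1, 2, 3], fun y => by
      rw [Term.realize_relabel]
      congr 1
      funext k
      fin_cases k <;> rfl⟩
  refine .tail (.single (b := g) ⟨fun y z => ?_, Or.inl fun y z => ?_⟩)
    ⟨fun y z => ?_, Or.inr fun x y z => ?_⟩
  · exact (h2 z y).symm
  · exact (h1 y z).symm
  · exact h2 z y
  · exact h2 y z

end TermOp

/-! ### Consequences of Day terms for the commutator -/

section Commutator

variable {L : FirstOrder.Language.{u, v}} {A : Type w} [L.Structure A]

/-- Along a chain of Day terms `m`, the elements `p` and `m(p, p, q, q)` stay `𝒲`-close, where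
`p = t(a', b)` and `q = t(a', c)`; at the end of the chain, `m(p, p, q, q) = q`. -/
theorem CentralDiff.centralizes {𝒰 𝒱 𝒲 : Unif L A} (hDay : HasDayTerms L A)
    (h : CentralDiff 𝒰 𝒱 𝒲) : Centralizes 𝒰 𝒱 𝒲 := by
  intro n n' t
  have key : ∀ m : TermOp L A (Fin 4), Relation.ReflTransGen DayStep (TermOp.proj L A 0) m →
      (∀ y z : A, m.toFun ![y, z, z, y] = y) ∧
      ∀ W ∈ 𝒲.ent, ∃ U ∈ 𝒰.ent, ∃ V ∈ 𝒱.ent, ∃ W' ∈ 𝒲.ent,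
        ∀ (a a' : Fin n → A) (b c : Fin n' → A),
        (∀ i, (a i, a' i) ∈ U) → (∀ j, (b j, c j) ∈ V) →
        (t.realize (Sum.elim a b), t.realize (Sum.elim a c)) ∈ W' →
        (t.realize (Sum.elim a' b), m.toFun ![t.realize (Sum.elim a' b),
          t.realize (Sum.elim a' b), t.realize (Sum.elim a' c), t.realize (Sum.elim a' c)]) ∈ W := by
    intro m hm
    induction hm with
    | refl =>
      refine ⟨fun _ _ => rfl, fun W hW => ⟨_, Filter.univ_mem, _, Filter.univ_mem, _,
        Filter.univ_mem, fun _ _ _ _ _ _ _ => Unif.ent_refl hW _⟩⟩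
    | @tail m m' _ hstep ih =>
      obtain ⟨ih1, ih2⟩ := ih
      obtain ⟨hφ, hstep⟩ := hstep
      have hm' : ∀ y z : A, m'.toFun ![y, z, z, y] = y := fun y z => (hφ y z).symm.trans (ih1 y z)
      refine ⟨hm', fun W hW => ?_⟩
      rcases hstep with hθ | hψ
      · simpa only [hθ] using ih2 W hW
      · obtain ⟨s, hs⟩ := m.isTerm
        obtain ⟨s', hs'⟩ := m'.isTerm
        obtain ⟨W₁, hW₁, hcomp₁⟩ := Unif.ent_comp hW
        obtain ⟨W₂, hW₂, hcomp₂⟩ := Unif.ent_comp hW₁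
        obtain ⟨W₃, hW₃, hcomp₃⟩ := Unif.ent_comp hW₂
        obtain ⟨W₄, hW₄, hsymm⟩ := Unif.ent_symm hW₃
        obtain ⟨W₅, hW₅, huc⟩ := 𝒲.exists_ent_term s _ hW₄
        obtain ⟨W₆, hW₆, huc'⟩ := 𝒲.exists_ent_term s' _ hW₃
        obtain ⟨U₀, hU₀, V₀, hV₀, W₀, hW₀, h₀⟩ := ih2 W₂ hW₂
        obtain ⟨U₁, hU₁, V₁, hV₁, h₁⟩ := h s (fun y z => (hs _).trans (ih1 y z)) n n' t W₃ hW₃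
        obtain ⟨U₂, hU₂, V₂, hV₂, h₂⟩ := h s' (fun y z => (hs' _).trans (hm' y z)) n n' t W₄ hW₄
        refine ⟨U₀ ∩ (U₁ ∩ U₂), Filter.inter_mem hU₀ (Filter.inter_mem hU₁ hU₂),
          V₀ ∩ (V₁ ∩ V₂), Filter.inter_mem hV₀ (Filter.inter_mem hV₁ hV₂),
          W₀ ∩ (W₅ ∩ W₆), Filter.inter_mem hW₀ (Filter.inter_mem hW₅ hW₆),
          fun a a' b c ha hb hab => ?_⟩
        have k₀ := h₀ a a' b c (fun i => (ha i).1) (fun j => (hb j).1) hab.1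
        have k₁ := h₁ a a' b c (fun i => (ha i).2.1) (fun j => (hb j).2.1)
        have k₂ := hsymm _ _ (h₂ a a' b c (fun i => (ha i).2.2) (fun j => (hb j).2.2))
        generalize t.realize (Sum.elim a' b) = p at *
        generalize t.realize (Sum.elim a' c) = q at *
        generalize t.realize (Sum.elim a b) = r at *
        generalize t.realize (Sum.elim a c) = r' at *
        -- The two middle terms `m(p, r, r, q)` and `m'(p, r, r, q)` coincide.
        have k₃ := hsymm _ _ (huc ![p, r, r, q] ![p, r, r', q] (by
          intro i
          fin_cases i
          · exact Unif.ent_refl hW₅ _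
          · exact Unif.ent_refl hW₅ _
          · exact hab.2.1
          · exact Unif.ent_refl hW₅ _))
        have k₄ := huc' ![p, r, r, q] ![p, r, r', q] (by
          intro i
          fin_cases i
          · exact Unif.ent_refl hW₆ _
          · exact Unif.ent_refl hW₆ _
          · exact hab.2.2
          · exact Unif.ent_refl hW₆ _)
        rw [hs] at k₁ k₃
        rw [hs] at k₁ k₃
        rw [hs'] at k₂ k₄
        rw [hs'] at k₂ k₄
        rw [hψ] at k₃
        have e₁ := hcomp₃ _ _ _ k₁ k₃
        have e₂ := hcomp₃ _ _ _ k₄ k₂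
        have e₃ : (p, m'.toFun ![p, r, r, q]) ∈ W₁ := hcomp₂ _ _ _ k₀ e₁
        have e₄ : (m'.toFun ![p, r, r, q], m'.toFun ![p, p, q, q]) ∈ W₁ :=
          hcomp₂ _ _ _ e₂ (Unif.ent_refl hW₂ _)
        exact hcomp₁ _ _ _ e₃ e₄
  exact (key _ hDay).2

theorem centralizes_iff_centralDiff (hDay : HasDayTerms L A) {𝒰 𝒱 𝒲 : Unif L A} :
    Centralizes 𝒰 𝒱 𝒲 ↔ CentralDiff 𝒰 𝒱 𝒲 :=
  ⟨fun h => (h.centralDiff.centralizes hDay).centralDiff, fun h => h.centralizes hDay⟩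

theorem comm_le_iff (hDay : HasDayTerms L A) {𝒰 𝒱 𝒲 : Unif L A} :
    comm 𝒰 𝒱 ≤ 𝒲 ↔ Centralizes 𝒰 𝒱 𝒲 := by
  refine ⟨fun h => ?_, fun h => (isLeast_comm 𝒰 𝒱).2 h⟩
  have h1 := (centralizes_iff_centralDiff hDay).1 (isLeast_comm 𝒰 𝒱).1
  exact (h1.mono h).centralizes hDay

theorem comm_comm (hDay : HasDayTerms L A) (𝒰 𝒱 : Unif L A) : comm 𝒰 𝒱 = comm 𝒱 𝒰 := by
  have : ∀ 𝒰 𝒱 : Unif L A, Centralizes 𝒰 𝒱 = Centralizes 𝒱 𝒰 := fun 𝒰 𝒱 => funext fun 𝒲 =>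
    propext ⟨fun h => h.centralDiff.centralizes hDay, fun h => h.centralDiff.centralizes hDay⟩
  unfold comm
  rw [this]

theorem Centralizes.antitone_left {𝒰 𝒰' 𝒱 𝒲 : Unif L A} (h : Centralizes 𝒰' 𝒱 𝒲) (hle : 𝒰 ≤ 𝒰') :
    Centralizes 𝒰 𝒱 𝒲 := by
  intro n n' t W hW
  obtain ⟨U, hU, rest⟩ := h n n' t W hW
  exact ⟨U, Unif.le_iff.1 hle U hU, rest⟩

theorem iSup_comm_le {I : Type*} (𝒰 : I → Unif L A) (𝒱 : Unif L A) :
    ⨆ i, comm (𝒰 i) 𝒱 ≤ comm (⨆ i, 𝒰 i) 𝒱 :=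
  iSup_le fun i => (isLeast_comm _ _).2 ((isLeast_comm _ _).1.antitone_left (le_iSup 𝒰 i))

end Commutator

/-! ### Joins of permuting uniformities -/

section Permuting

variable {L : FirstOrder.Language.{u, v}} {A : Type w} [L.Structure A]

/-- One inclusion of `𝒰 ∘ 𝒱 = 𝒱 ∘ 𝒰`, in terms of entourages. It implies the other one, because
entourages may be inverted. -/
def SemiPermute (𝒰 𝒱 : Unif L A) : Prop :=
  ∀ U ∈ 𝒰.ent, ∀ V ∈ 𝒱.ent, ∃ V' ∈ 𝒱.ent, ∃ U' ∈ 𝒰.ent,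
    ∀ a b c, (a, b) ∈ V' → (b, c) ∈ U' → ∃ d, (a, d) ∈ U ∧ (d, c) ∈ V

theorem Permute.semiPermute {𝒰 𝒱 : Unif L A} (h : Permute 𝒰 𝒱) : SemiPermute 𝒰 𝒱 := by
  intro U hU V hV
  have h1 : U ○ V ∈ 𝒰.ent.lift fun U => 𝒱.ent.lift' fun V => U ○ V :=
    Filter.mem_of_superset (Filter.mem_lift hU (Filter.mem_lift' hV)) fun _ h => h
  rw [h] at h1
  have mono : ∀ V : Set (A × A), Monotone fun U : Set (A × A) => V ○ U :=
    fun V U U' hUU' p ⟨b, h1, h2⟩ => ⟨b, h1, hUU' h2⟩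
  rw [Filter.mem_lift_sets] at h1
  · obtain ⟨V', hV', h1⟩ := h1
    rw [Filter.mem_lift'_sets (mono V')] at h1
    obtain ⟨U', hU', h1⟩ := h1
    exact ⟨V', hV', U', hU', fun a b c hab hbc =>
      h1 (show (a, c) ∈ V' ○ U' from ⟨b, hab, hbc⟩)⟩
  · intro V V' hVV'
    exact Filter.lift'_mono' fun U _ p ⟨b, h1, h2⟩ => ⟨b, hVV' h1, h2⟩

theorem SemiPermute.symm {𝒰 𝒱 : Unif L A} (h : SemiPermute 𝒰 𝒱) : SemiPermute 𝒱 𝒰 := by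
  intro V hV U hU
  obtain ⟨V₁, hV₁, hV₁'⟩ := Unif.ent_symm hV
  obtain ⟨U₁, hU₁, hU₁'⟩ := Unif.ent_symm hU
  obtain ⟨V₂, hV₂, U₂, hU₂, H⟩ := h U₁ hU₁ V₁ hV₁
  obtain ⟨V₃, hV₃, hV₃'⟩ := Unif.ent_symm hV₂
  obtain ⟨U₃, hU₃, hU₃'⟩ := Unif.ent_symm hU₂
  refine ⟨U₃, hU₃, V₃, hV₃, fun a b c hab hbc => ?_⟩
  obtain ⟨d, h1, h2⟩ := H c b a (hV₃' _ _ hbc) (hU₃' _ _ hab)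
  exact ⟨d, hV₁' _ _ h2, hU₁' _ _ h1⟩

/-- The join is obtained by exhibiting the compositions `U ∘ V` as a base of a compatible
uniformity above both `𝒰` and `𝒱`. -/
theorem SemiPermute.comp_mem_sup {𝒰 𝒱 : Unif L A} (h : SemiPermute 𝒰 𝒱) {U V : Set (A × A)}
    (hU : U ∈ 𝒰.ent) (hV : V ∈ 𝒱.ent) :
    {p : A × A | ∃ d, (p.1, d) ∈ U ∧ (d, p.2) ∈ V} ∈ (𝒰 ⊔ 𝒱).ent := by
  let T (k : {U // U ∈ 𝒰.ent} × {V // V ∈ 𝒱.ent}) : Set (A × A) :=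
    {p : A × A | ∃ d, (p.1, d) ∈ k.1.1 ∧ (d, p.2) ∈ k.2.1}
  have hT : ∀ k, T k ∈ ⨅ k, Filter.principal (T k) :=
    fun k => Filter.mem_iInf_of_mem k (Filter.mem_principal_self _)
  obtain ⟨𝒯, h𝒯⟩ : ∃ 𝒯 : Unif L A, 𝒯.ent = ⨅ k, Filter.principal (T k) := by
    refine exists_unif_of_relations T ?_ ?_ ?_ ?_
    · exact fun k a => ⟨a, Unif.ent_refl k.1.2 a, Unif.ent_refl k.2.2 a⟩
    · rintro ⟨⟨U, hU⟩, ⟨V, hV⟩⟩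
      obtain ⟨V₁, hV₁, U₁, hU₁, H⟩ := h U hU V hV
      obtain ⟨V₂, hV₂, hV₂'⟩ := Unif.ent_symm hV₁
      obtain ⟨U₂, hU₂, hU₂'⟩ := Unif.ent_symm hU₁
      refine ⟨⟨⟨U₂, hU₂⟩, ⟨V₂, hV₂⟩⟩, ?_⟩
      rintro a b ⟨d, h1, h2⟩
      exact H b d a (hV₂' _ _ h2) (hU₂' _ _ h1)
    · rintro ⟨⟨U, hU⟩, ⟨V, hV⟩⟩
      -- `U₁ ∘ V₁ ∘ U₁ ∘ V₁` is refined to `U₁ ∘ U₁ ∘ V₁ ∘ V₁` by permuting the middle factors.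
      obtain ⟨U₁, hU₁, hUc⟩ := Unif.ent_comp hU
      obtain ⟨V₁, hV₁, hVc⟩ := Unif.ent_comp hV
      obtain ⟨V₂, hV₂, U₂, hU₂, H⟩ := h U₁ hU₁ V₁ hV₁
      refine ⟨⟨⟨U₁ ∩ U₂, Filter.inter_mem hU₁ hU₂⟩, ⟨V₁ ∩ V₂, Filter.inter_mem hV₁ hV₂⟩⟩, ?_⟩
      rintro a b c ⟨d, h1, h2⟩ ⟨e, h3, h4⟩
      obtain ⟨g, h5, h6⟩ := H d b e h2.2 h3.2
      exact ⟨g, hUc _ _ _ h1.1 h5, hVc _ _ _ h6 h4.1⟩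
    · rintro n f ⟨⟨U, hU⟩, ⟨V, hV⟩⟩
      obtain ⟨U₁, hU₁, hU₁'⟩ := 𝒰.2 f U hU
      obtain ⟨V₁, hV₁, hV₁'⟩ := 𝒱.2 f V hV
      refine ⟨_, hT ⟨⟨U₁, hU₁⟩, ⟨V₁, hV₁⟩⟩, fun a b hab => ?_⟩
      choose d h1 h2 using hab
      exact ⟨Structure.funMap f d, hU₁' _ _ h1, hV₁' _ _ h2⟩
  have hle : 𝒰 ⊔ 𝒱 ≤ 𝒯 := by
    have aux : ∀ 𝒳 : Unif L A, (∀ k, T k ∈ 𝒳.ent) → 𝒳 ≤ 𝒯 := by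
      intro 𝒳 hk
      have : 𝒳.ent ≤ 𝒯.ent := h𝒯 ▸ le_iInf fun k => Filter.le_principal_iff.2 (hk k)
      exact Unif.le_iff.2 fun X hX => this hX
    refine sup_le (aux _ ?_) (aux _ ?_)
    · exact fun k => Filter.mem_of_superset k.1.2 fun p hp => ⟨p.2, hp, Unif.ent_refl k.2.2 _⟩
    · exact fun k => Filter.mem_of_superset k.2.2 fun p hp => ⟨p.1, Unif.ent_refl k.1.2 _, hp⟩
  refine Unif.le_iff.1 hle _ ?_
  rw [h𝒯]
  exact hT ⟨⟨U, hU⟩, ⟨V, hV⟩⟩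

theorem SemiPermute.sup_left {𝒰 𝒱 𝒳 : Unif L A} (h : SemiPermute 𝒰 𝒱) (h1 : SemiPermute 𝒰 𝒳)
    (h2 : SemiPermute 𝒱 𝒳) : SemiPermute (𝒰 ⊔ 𝒱) 𝒳 := by
  intro Y hY X hX
  obtain ⟨Y', hY', hYc⟩ := Unif.ent_comp hY
  have hU : Y' ∈ 𝒰.ent := Unif.le_iff.1 le_sup_left Y' hY'
  have hV : Y' ∈ 𝒱.ent := Unif.le_iff.1 le_sup_right Y' hY'
  obtain ⟨X₁, hX₁, V₁, hV₁, H₁⟩ := h2 Y' hV X hX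
  obtain ⟨X₂, hX₂, U₂, hU₂, H₂⟩ := h1 Y' hU X₁ hX₁
  refine ⟨X₂, hX₂, _, h.comp_mem_sup hU₂ hV₁, ?_⟩
  rintro a b c hab ⟨d, hbd, hdc⟩
  obtain ⟨e, h3, h4⟩ := H₂ a b d hab hbd
  obtain ⟨g, h5, h6⟩ := H₁ e d c h4 hdc
  exact ⟨g, hYc _ _ _ h3 h5, h6⟩

theorem SemiPermute.centralizes_sup {𝒰 𝒰' 𝒱 𝒲 : Unif L A} (h : SemiPermute 𝒰 𝒰')
    (h1 : Centralizes 𝒰 𝒱 𝒲) (h2 : Centralizes 𝒰' 𝒱 𝒲) : Centralizes (𝒰 ⊔ 𝒰') 𝒱 𝒲 := by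
  intro n n' t W hW
  obtain ⟨U₂, hU₂, V₂, hV₂, W₂, hW₂, H₂⟩ := h2 n n' t W hW
  obtain ⟨U₁, hU₁, V₁, hV₁, W₁, hW₁, H₁⟩ := h1 n n' t W₂ hW₂
  refine ⟨_, h.comp_mem_sup hU₁ hU₂, V₁ ∩ V₂, Filter.inter_mem hV₁ hV₂, W₁, hW₁, ?_⟩
  intro a a' b c ha hb hab
  choose d hd1 hd2 using ha
  exact H₂ d a' b c hd2 (fun j => (hb j).2) (H₁ a d b c hd1 (fun j => (hb j).1) hab)

theorem diagonal_mem_bot : {p : A × A | p.1 = p.2} ∈ (⊥ : Unif L A).ent := by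
  obtain ⟨𝒯, h𝒯⟩ := exists_unif_of_congruence (L := L) (A := A) ⟨⊥, fun n f a b h =>
    congrArg (Structure.funMap f) (funext h)⟩
  refine Unif.le_iff.1 (bot_le : ⊥ ≤ 𝒯) _ ?_
  rw [h𝒯]
  exact Filter.mem_principal_self _

theorem centralizes_bot (𝒱 𝒲 : Unif L A) : Centralizes ⊥ 𝒱 𝒲 := by
  intro n n' t W hW
  refine ⟨_, diagonal_mem_bot, Set.univ, Filter.univ_mem, W, hW, fun a a' b c ha _ h => ?_⟩
  obtain rfl : a = a' := funext ha
  exact h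

theorem SemiPermute.bot_left (𝒱 : Unif L A) : SemiPermute ⊥ 𝒱 := by
  intro U hU V hV
  refine ⟨V, hV, {p | p.1 = p.2}, ?_, fun a b c hab hbc => ?_⟩
  · exact diagonal_mem_bot
  · obtain rfl : b = c := hbc
    exact ⟨a, Unif.ent_refl hU a, hab⟩

theorem centralizes_iSup {I : Type*} [Finite I] {𝒰 : I → Unif L A} {𝒱 𝒲 : Unif L A}
    (hperm : ∀ i j, SemiPermute (𝒰 i) (𝒰 j)) (h : ∀ i, Centralizes (𝒰 i) 𝒱 𝒲) :
    Centralizes (⨆ i, 𝒰 i) 𝒱 𝒲 := by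
  classical
  have := Fintype.ofFinite I
  have key : ∀ s : Finset I, (∀ j, SemiPermute (s.sup 𝒰) (𝒰 j)) ∧ Centralizes (s.sup 𝒰) 𝒱 𝒲 := by
    intro s
    induction s using Finset.induction_on with
    | empty => exact ⟨fun j => .bot_left _, centralizes_bot _ _⟩
    | insert i s _ ih =>
      rw [Finset.sup_insert]
      exact ⟨fun j => (ih.1 i).symm.sup_left (hperm i j) (ih.1 j),
        (ih.1 i).symm.centralizes_sup (h i) ih.2⟩
  rw [← Finset.sup_univ_eq_iSup]
  exact (key Finset.univ).2

theorem comm_iSup_of_permute (hDay : HasDayTerms L A) {I : Type*} [Finite I] {𝒰 : I → Unif L A}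
    (hperm : ∀ i j, SemiPermute (𝒰 i) (𝒰 j)) (𝒱 : Unif L A) :
    comm (⨆ i, 𝒰 i) 𝒱 = ⨆ i, comm (𝒰 i) 𝒱 := by
  refine le_antisymm ((comm_le_iff hDay).2 (centralizes_iSup hperm fun i => ?_)) (iSup_comm_le _ _)
  exact (comm_le_iff hDay).1 (le_iSup (fun i => comm (𝒰 i) 𝒱) i)

/-- A Mal'cev operation turns `a 𝒱 b 𝒰 c` into `a 𝒰 p(a, b, c) 𝒱 c`. -/
theorem semiPermute_of_malcev (p : L.Term (Fin 3)) (h1 : ∀ y z : A, p.realize ![y, z, z] = y)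
    (h2 : ∀ y z : A, p.realize ![y, y, z] = z) (𝒰 𝒱 : Unif L A) : SemiPermute 𝒰 𝒱 := by
  intro U hU V hV
  obtain ⟨U', hU', HU⟩ := 𝒰.exists_ent_term p U hU
  obtain ⟨V', hV', HV⟩ := 𝒱.exists_ent_term p V hV
  refine ⟨V', hV', U', hU', fun a b c hab hbc => ⟨p.realize ![a, b, c], ?_, ?_⟩⟩
  · have := HU ![a, b, b] ![a, b, c] (by
      intro i
      fin_cases i
      · exact Unif.ent_refl hU' _
      · exact Unif.ent_refl hU' _
      · exact hbc)
    rwa [h1] at this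
  · have := HV ![a, b, c] ![b, b, c] (by
      intro i
      fin_cases i
      · exact hab
      · exact Unif.ent_refl hV' _
      · exact Unif.ent_refl hV' _)
    rwa [h2] at this

end Permuting

/-! ### Infinite joins in the presence of a group structure -/

section Group

variable {L : FirstOrder.Language.{u, v}} {A : Type w} [L.Structure A]

/-- A family of functions that is uniformly equicontinuous in each of finitely many variables,
also with respect to the values of the other variables, is uniformly equicontinuous in all
variables together. -/
theorem exists_ent_of_update {P : Type*} {n : ℕ} (F : P → (Fin n → A) → A) {l : Filter (A × A)}
    {𝒲 : Unif L A}
    (h : ∀ i, ∀ W ∈ 𝒲.ent, ∃ U ∈ l, ∀ q e x x', (x, x') ∈ U →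
      (F q (Function.update e i x), F q (Function.update e i x')) ∈ W) :
    ∀ W ∈ 𝒲.ent, ∃ U ∈ l, ∀ q a a', (∀ i, (a i, a' i) ∈ U) → (F q a, F q a') ∈ W := by
  have key : ∀ s : Finset (Fin n), ∀ W ∈ 𝒲.ent, ∃ U ∈ l, ∀ q a a', (∀ i ∈ s, (a i, a' i) ∈ U) →
      (∀ i ∉ s, a i = a' i) → (F q a, F q a') ∈ W := by
    intro s
    induction s using Finset.induction_on with
    | empty =>
      refine fun W hW => ⟨Set.univ, Filter.univ_mem, fun q a a' _ heq => ?_⟩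
      obtain rfl : a = a' := funext fun i => heq i (Finset.notMem_empty i)
      exact Unif.ent_refl hW _
    | insert i s hi ih =>
      intro W hW
      obtain ⟨W', hW', hcomp⟩ := Unif.ent_comp hW
      obtain ⟨U₁, hU₁, H₁⟩ := ih W' hW'
      obtain ⟨U₂, hU₂, H₂⟩ := h i W' hW'
      refine ⟨U₁ ∩ U₂, Filter.inter_mem hU₁ hU₂, fun q a a' ha heq => ?_⟩
      -- The coordinate `i` is moved last.
      have k₁ := H₁ q a (Function.update a' i (a i)) (fun j hj => ?_) fun j hj => ?_
      · have k₂ := H₂ q a' _ _ (ha i (Finset.mem_insert_self i s)).2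
        rw [Function.update_eq_self] at k₂
        exact hcomp _ _ _ k₁ k₂
      · have hji : j ≠ i := fun h => hi (h ▸ hj)
        simpa [hji] using (ha j (Finset.mem_insert_of_mem hj)).1
      · by_cases hji : j = i
        · subst hji; simp
        · simpa [hji] using heq j (by simp [hji, hj])
  intro W hW
  obtain ⟨U, hU, H⟩ := key Finset.univ W hW
  exact ⟨U, hU, fun q a a' ha => H q a a' (fun i _ => ha i) fun i hi => absurd (Finset.mem_univ i) hi⟩

/-- For congruence-generated `𝒱 = Ug {α}` in the presence of a group structure, `CentralDiff` says
that the functions `a ↦ t(a, b) t(a, c)⁻¹`, for `b α c`, are uniformly equicontinuous from `𝒰` to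
`𝒲`. There is a largest compatible uniformity that makes all of them equicontinuous. -/
theorem centralizes_iSup_of_group (hgrp : HasUnderlyingGroup L A) {α : Congruence L A}
    {I : Type*} {𝒰 : I → Unif L A} {𝒲 : Unif L A}
    (h : ∀ i, CentralDiff (𝒰 i) (ugCongruence α) 𝒲) :
    Centralizes (⨆ i, 𝒰 i) (ugCongruence α) 𝒲 := by
  obtain ⟨_, m, inv, hm, hinv⟩ := hgrp
  let ratio {n n' : ℕ} (t : L.Term (Fin n ⊕ Fin n')) (a : Fin n → A) (b c : Fin n' → A) : A :=
    t.realize (Sum.elim a b) * (t.realize (Sum.elim a c))⁻¹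
  have hmul : ∀ W ∈ 𝒲.ent, ∃ W' ∈ 𝒲.ent, ∀ x y z : A, (x, y) ∈ W' → (x * z, y * z) ∈ W := by
    intro W hW
    obtain ⟨W', hW', H⟩ := 𝒲.exists_ent_term m W hW
    refine ⟨W', hW', fun x y z hxy => ?_⟩
    have := H ![x, z] ![y, z] (by
      intro i
      fin_cases i
      · exact hxy
      · exact Unif.ent_refl hW' _)
    rwa [hm, hm] at this
  have hratio : ∀ (i : I) {n n' : ℕ} (t : L.Term (Fin n ⊕ Fin n')), ∀ W ∈ 𝒲.ent,
      ∃ U ∈ (𝒰 i).ent, ∀ a a' b c, (∀ i, (a i, a' i) ∈ U) → (∀ j, α.1.r (b j) (c j)) →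
        (ratio t a b c, ratio t a' b c) ∈ W := by
    intro i n n' t W hW
    -- The term `y z⁻¹ u` in the variables `x, y, z, u`.
    let d : L.Term (Fin 4) :=
      m.subst ![m.subst ![Term.var 1, (inv.subst ![Term.var 2])], Term.var 3]
    have hsub : ∀ (s₁ s₂ : L.Term (Fin 4)) (y : Fin 4 → A),
        (m.subst ![s₁, s₂]).realize y = s₁.realize y * s₂.realize y := by
      intro s₁ s₂ y
      rw [Term.realize_subst, ← hm]
      congr 1
      funext k
      fin_cases k <;> rfl
    have hsub' : ∀ (s : L.Term (Fin 4)) (y : Fin 4 → A),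
        (inv.subst ![s]).realize y = (s.realize y)⁻¹ := by
      intro s y
      rw [Term.realize_subst, ← hinv]
      congr 1
      funext k
      fin_cases k; rfl
    have hd : ∀ x y z u : A, d.realize ![x, y, z, u] = y * z⁻¹ * u := by
      intro x y z u
      simp only [d, hsub, hsub']
      rfl
    obtain ⟨W₁, hW₁, hsymm⟩ := Unif.ent_symm hW
    obtain ⟨W₂, hW₂, hW₂'⟩ := hmul W₁ hW₁
    obtain ⟨U, hU, V, hV, H⟩ := h i d (fun y z => by simp [hd]) n n' t W₂ hW₂
    rw [ugCongruence_ent] at hV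
    refine ⟨U, hU, fun a a' b c ha hb => hsymm _ _ ?_⟩
    have := hW₂' _ _ (t.realize (Sum.elim a' c))⁻¹ (H a a' b c ha fun j => hV (hb j))
    simpa [hd, ratio] using this
  -- Equicontinuity is imposed in one variable of `t` at a time.
  let T (k : (Σ n n' : ℕ, L.Term (Fin n ⊕ Fin n') × Fin n) × {W // W ∈ 𝒲.ent}) : Set (A × A) :=
    {p | ∀ (e : Fin k.1.1 → A) (b c : Fin k.1.2.1 → A), (∀ j, α.1.r (b j) (c j)) →
      (ratio k.1.2.2.1 (Function.update e k.1.2.2.2 p.1) b c,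
        ratio k.1.2.2.1 (Function.update e k.1.2.2.2 p.2) b c) ∈ k.2.1}
  have hT : ∀ k, T k ∈ ⨅ k, Filter.principal (T k) :=
    fun k => Filter.mem_iInf_of_mem k (Filter.mem_principal_self _)
  have hrefl : ∀ U ∈ ⨅ k, Filter.principal (T k), ∀ a, (a, a) ∈ U := by
    intro U hU a
    have : pure (a, a) ≤ ⨅ k, Filter.principal (T k) :=
      le_iInf fun k => Filter.le_principal_iff.2 fun _ _ _ _ => Unif.ent_refl k.2.2 _
    exact this hU
  have hjoint : ∀ {n n' : ℕ} (t : L.Term (Fin n ⊕ Fin n')), ∀ W ∈ 𝒲.ent,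
      ∃ U ∈ ⨅ k, Filter.principal (T k), ∀ a a' b c, (∀ i, (a i, a' i) ∈ U) →
        (∀ j, α.1.r (b j) (c j)) → (ratio t a b c, ratio t a' b c) ∈ W := by
    intro n n' t W hW
    obtain ⟨U, hU, H⟩ := exists_ent_of_update
      (P := {q : (Fin n' → A) × (Fin n' → A) // ∀ j, α.1.r (q.1 j) (q.2 j)})
      (fun q a => ratio t a q.1.1 q.1.2) (l := ⨅ k, Filter.principal (T k)) (𝒲 := 𝒲)
      (fun i W hW => ⟨_, hT ⟨⟨n, n', t, i⟩, ⟨W, hW⟩⟩,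
        fun q e x x' hx => hx e q.1.1 q.1.2 q.2⟩) W hW
    exact ⟨U, hU, fun a a' b c ha hb => H ⟨(b, c), hb⟩ a a' ha⟩
  obtain ⟨𝒯, h𝒯⟩ : ∃ 𝒯 : Unif L A, 𝒯.ent = ⨅ k, Filter.principal (T k) := by
    refine exists_unif_of_relations T ?_ ?_ ?_ ?_
    · exact fun k a => hrefl _ (hT k) a
    · rintro ⟨κ, ⟨W, hW⟩⟩
      obtain ⟨W', hW', hsymm⟩ := Unif.ent_symm hW
      exact ⟨⟨κ, ⟨W', hW'⟩⟩, fun x y hxy e b c hb => hsymm _ _ (hxy e b c hb)⟩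
    · rintro ⟨κ, ⟨W, hW⟩⟩
      obtain ⟨W', hW', hcomp⟩ := Unif.ent_comp hW
      exact ⟨⟨κ, ⟨W', hW'⟩⟩, fun x y z hxy hyz e b c hb =>
        hcomp _ _ _ (hxy e b c hb) (hyz e b c hb)⟩
    · rintro k f ⟨⟨n, n', t, i⟩, ⟨W, hW⟩⟩
      -- Substituting `f` for the variable `i` of `t` gives another term.
      let s : L.Term (Fin (n + k) ⊕ Fin n') :=
        t.subst (Sum.elim (fun j => if j = i then
            Term.func f fun l => Term.var (Sum.inl (Fin.natAdd n l))
          else Term.var (Sum.inl (Fin.castAdd k j))) fun j => Term.var (Sum.inr j))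
      have hs : ∀ (e : Fin n → A) (x : Fin k → A) (b : Fin n' → A),
          s.realize (Sum.elim (Fin.append e x) b) =
            t.realize (Sum.elim (Function.update e i (Structure.funMap f x)) b) := by
        intro e x b
        rw [Term.realize_subst]
        congr 1
        funext j
        rcases j with j | j
        · by_cases hj : j = i
          · subst hj; simp
          · simp [hj]
        · rfl
      obtain ⟨U, hU, H⟩ := hjoint s W hW
      refine ⟨U, hU, fun x x' hx e b c hb => ?_⟩
      have := H (Fin.append e x) (Fin.append e x') b c (fun j => ?_) hb
      · simpa only [ratio, hs] using this
      · refine Fin.addCases (fun j => ?_) (fun j => ?_) j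
        · simpa only [Fin.append_left] using hrefl U hU _
        · simpa only [Fin.append_right] using hx j
  have hle : ⨆ i, 𝒰 i ≤ 𝒯 := by
    refine iSup_le fun i => ?_
    have : (𝒰 i).ent ≤ 𝒯.ent := by
      rw [h𝒯]
      refine le_iInf fun k => Filter.le_principal_iff.2 ?_
      obtain ⟨⟨n, n', t, l⟩, ⟨W, hW⟩⟩ := k
      obtain ⟨U, hU, H⟩ := hratio i t W hW
      refine Filter.mem_of_superset hU fun p hp e b c hb => H _ _ b c (fun j => ?_) hb
      by_cases hj : j = l
      · subst hj; simpa using hp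
      · simpa [hj] using Unif.ent_refl hU (e j)
    exact Unif.le_iff.2 fun X hX => this hX
  refine Centralizes.antitone_left (fun n n' t W hW => ?_) hle
  obtain ⟨W₁, hW₁, hW₁'⟩ := hmul W hW
  obtain ⟨W₂, hW₂, hcomp⟩ := Unif.ent_comp hW₁
  obtain ⟨W₃, hW₃, hsymm⟩ := Unif.ent_symm hW₂
  obtain ⟨W₄, hW₄, hW₄'⟩ := hmul W₂ hW₂
  obtain ⟨U, hU, H⟩ := hjoint t W₃ hW₃
  refine ⟨U, h𝒯 ▸ hU, _, (ugCongruence_ent α).symm ▸ Filter.mem_principal_self _, W₄, hW₄,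
    fun a a' b c ha hb hab => ?_⟩
  have k₁ := hsymm _ _ (H a a' b c ha hb)
  have k₂ : (ratio t a b c, 1) ∈ W₂ := by
    simpa [ratio] using hW₄' _ _ (t.realize (Sum.elim a c))⁻¹ hab
  simpa [ratio] using hW₁' _ _ (t.realize (Sum.elim a' c)) (hcomp _ _ _ k₁ k₂)

end Group

end UniformAlgebra

theorem theoremT (L : FirstOrder.Language.{u, v}) [L.IsAlgebraic]
    (E : UniformAlgebra.Identities L)
    (A : Type w) [L.Structure A] (hA : UniformAlgebra.Models E A) :
    (UniformAlgebra.CongruenceModular.{u, v, w} E →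
      ∀ (I : Type x) (𝒰 : I → UniformAlgebra.Unif L A) (𝒱 : UniformAlgebra.Unif L A),
        ((⨆ i, UniformAlgebra.comm (𝒰 i) 𝒱) ≤ UniformAlgebra.comm (⨆ i, 𝒰 i) 𝒱) ∧
        ((∃ α : UniformAlgebra.Congruence L A, 𝒱 = UniformAlgebra.ugCongruence α) →
          UniformAlgebra.HasUnderlyingGroup L A →
          (⨆ i, UniformAlgebra.comm (𝒰 i) 𝒱) = UniformAlgebra.comm (⨆ i, 𝒰 i) 𝒱) ∧
        (Finite I → (∀ i j, UniformAlgebra.Permute (𝒰 i) (𝒰 j)) →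
          (⨆ i, UniformAlgebra.comm (𝒰 i) 𝒱) = UniformAlgebra.comm (⨆ i, 𝒰 i) 𝒱)) ∧
    (UniformAlgebra.CongruencePermutable.{u, v, w} E →
      ∀ (I : Type x) [Finite I] (𝒰 : I → UniformAlgebra.Unif L A) (𝒱 : UniformAlgebra.Unif L A),
        UniformAlgebra.comm (⨆ i, 𝒰 i) 𝒱 = (⨆ i, UniformAlgebra.comm (𝒰 i) 𝒱) ∧
        UniformAlgebra.comm 𝒱 (⨆ i, 𝒰 i) = (⨆ i, UniformAlgebra.comm 𝒱 (𝒰 i))) := by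
  open UniformAlgebra in
  refine ⟨fun hE I 𝒰 𝒱 => ⟨iSup_comm_le 𝒰 𝒱, ?_, fun _ hperm => ?_⟩, fun hE I _ 𝒰 𝒱 => ?_⟩
  · rintro ⟨α, rfl⟩ hgrp
    have hDay := hasDayTerms_of_modular hA hE
    refine le_antisymm (iSup_comm_le _ _) ((isLeast_comm _ _).2 ?_)
    exact centralizes_iSup_of_group hgrp fun i => (centralizes_iff_centralDiff hDay).1 <|
      (comm_le_iff hDay).1 (le_iSup (fun i => comm (𝒰 i) (ugCongruence α)) i)
  · exact (comm_iSup_of_permute (hasDayTerms_of_modular hA hE)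
      (fun i j => (hperm i j).semiPermute) 𝒱).symm
  · obtain ⟨p, h1, h2⟩ := exists_malcev hA hE
    have hDay := hasDayTerms_of_malcev p h1 h2
    have hadd := comm_iSup_of_permute hDay
      (fun i j => semiPermute_of_malcev p h1 h2 (𝒰 i) (𝒰 j)) 𝒱
    refine ⟨hadd, ?_⟩
    rw [comm_comm hDay, hadd]
    exact iSup_congr fun i => comm_comm hDay _ _
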